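/- Call a simplicial set $X$ \emph{$1$-reduced} if it has a unique $0$-simplex and the degeneracy of that $0$-simplex is its unique $1$-simplex (equivalently, its $1$-skeleton $\operatorname{sk}_1(X)$ is a point), and let $\mathcal{SS}\mathrm{ets}_1$ be the category of $1$-reduced simplicial sets and simplicial maps. In its model structure a map $f$ is a weak equivalence if and only if its geometric realization $|f|$ is a weak homotopy equivalence, and a cofibration if and only if $f$ is a monomorphism; thus a map is a fibration in $\mathcal{SS}\mathrm{ets}_1$ if and only if it has the right lifting property with respect to all monomorphisms $A \to B$ of $1$-reduced simplicial sets whose geometric realization is a weak homotopy equivalence. For a simplicial set $X$ let $R_1(X) = X/\operatorname{sk}_1(X)$ be its $1$-reduction (the pushout of $X \leftarrow \operatorname{sk}_1(X) \to \Delta[0]$), a functor from simplicial sets to $\mathcal{SS}\mathrm{ets}_1$. Let $S^2_{\mathrm{simp}} = \Delta[2]/\partial\Delta[2]$ be the simplicial $2$-sphere, and for $0 \le k \le 2$ let $j_{2,k} \colon \Lambda[2,k] \to \Delta[2]$ be the horn inclusion. \textbf{Proposition.} For every $0 \le k \le 2$, under suitable isomorphisms $R_1(\Lambda[2,k]) \cong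 \Delta[0]$ and $R_1(\Delta[2]) \cong S^2_{\mathrm{simp}}$, the map $R_1(j_{2,k})$ is the inclusion $\Delta[0] \to S^2_{\mathrm{simp}}$ of the basepoint. This map $R_1(j_{2,k})$ is a fibration in $\mathcal{SS}\mathrm{ets}_1$, but it is not a Kan fibration (that is, it does not have the right lifting property with respect to all horn inclusions $\Lambda[n,i] \to \Delta[n]$ with $n \ge 1$ and $0 \le i \le n$). -/

import Mathlib

open CategoryTheory Simplicial Opposite Limits

universe u

namespace OneReduced

/-! ### Weak homotopy equivalences of topological spaces -/

section Homotopy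

variable {X Y : Type u} [TopologicalSpace X] [TopologicalSpace Y]

/-- The map induced by a continuous map on sets of path components. -/
def zerothHomotopyMap (f : C(X, Y)) : ZerothHomotopy X → ZerothHomotopy Y :=
  ZerothHomotopy.lift (fun x => ZerothHomotopy.mk (f x))
    (fun _ _ p => ZerothHomotopy.sound (p.map f.continuous))

/-- Postcomposition of an `n`-dimensional loop at `x` with a continuous map. -/
def genLoopMap (f : C(X, Y)) (n : ℕ) (x : X) (p : GenLoop (Fin n) X x) :
    GenLoop (Fin n) Y (f x) :=
  ⟨f.comp p.1, fun y hy => congrArg f (p.2 y hy)⟩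

/-- The map `π_n(X, x) → π_n(Y, f x)` induced by a continuous map `f`. -/
def homotopyGroupMap (f : C(X, Y)) (n : ℕ) (x : X) :
    HomotopyGroup.Pi n X x → HomotopyGroup.Pi n Y (f x) :=
  Quotient.map (genLoopMap f n x) (fun _ _ h => h.map fun H => H.compContinuousMap f)

/-- A weak homotopy equivalence: a continuous map that is bijective on path components and
on all homotopy groups `π_n`, `n ≥ 1`, at all basepoints. -/
def IsWeakHomotopyEquiv (f : C(X, Y)) : Prop :=
  Function.Bijective (zerothHomotopyMap f) ∧
    ∀ (n : ℕ) (_ : 1 ≤ n) (x : X), Function.Bijective (homotopyGroupMap f n x)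

end Homotopy

/-! ### The category of `1`-reduced simplicial sets -/

/-- A simplicial set is `1`-reduced if it has a unique `0`-simplex, and the degeneracy of that
`0`-simplex is the unique `1`-simplex; that is, if its `1`-skeleton is a point. -/
def isOneReduced : ObjectProperty SSet.{u} := fun X =>
  ∃ x : X _⦋0⦌, (∀ y : X _⦋0⦌, y = x) ∧ ∀ e : X _⦋1⦌, e = X.σ 0 x

/-- The category of `1`-reduced simplicial sets and simplicial maps between them. -/
abbrev SSetOne : Type (u + 1) := (isOneReduced.{u}).FullSubcategory

/-- The inclusion functor from `1`-reduced simplicial sets to simplicial sets. -/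
abbrev forgetToSSet : SSetOne.{u} ⥤ SSet.{u} := (isOneReduced.{u}).ι

/-! ### Quotients and the `1`-reduction -/

/-- The quotient `X / A` of a simplicial set by a subcomplex, where `A` is collapsed to a point:
the pushout of `X ← A → Δ[0]`. -/
noncomputable def quotient (X : SSet.{u}) (A : X.Subcomplex) : SSet.{u} :=
  pushout A.ι (SSet.stdSimplex.isTerminalObj₀.from (A : SSet.{u}))

/-- The quotient map `X → X / A`. -/
noncomputable def quotientMap (X : SSet.{u}) (A : X.Subcomplex) : X ⟶ quotient X A :=
  pushout.inl _ _

/-- The basepoint `Δ[0] → X / A`. -/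
noncomputable def quotientBasepoint (X : SSet.{u}) (A : X.Subcomplex) : Δ[0] ⟶ quotient X A :=
  pushout.inr _ _

/-- The `1`-skeleton: Mathlib's `X.skeleton n` is generated by the simplices of
dimension `< n`. -/
abbrev skOne (X : SSet.{u}) : X.Subcomplex := X.skeleton 2

lemma skeleton_le_preimage {X Y : SSet.{u}} (f : X ⟶ Y) (n : ℕ) :
    X.skeleton n ≤ (Y.skeleton n).preimage f := by
  refine iSup_le fun i => iSup_le fun x => ?_
  rw [SSet.Subcomplex.ofSimplex_le_iff]
  exact Y.mem_skeleton (f.app _ x.1) i.2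

/-- The map on `1`-skeleta induced by a simplicial map. -/
def skOneMap {X Y : SSet.{u}} (f : X ⟶ Y) : (skOne X : SSet.{u}) ⟶ (skOne Y : SSet.{u}) :=
  SSet.Subcomplex.lift ((skOne X).ι ≫ f) (by
    rintro n _ ⟨x, rfl⟩
    exact skeleton_le_preimage f 2 n x.2)

lemma skOneMap_ι {X Y : SSet.{u}} (f : X ⟶ Y) : skOneMap f ≫ (skOne Y).ι = (skOne X).ι ≫ f := rfl

lemma quotient_cases {X : SSet.{u}} {A : X.Subcomplex} {n : SimplexCategoryᵒᵖ}
    (y : (quotient X A).obj n) :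
    (∃ x, (quotientMap X A).app n x = y) ∨ ∃ z, (quotientBasepoint X A).app n z = y :=
  Types.eq_or_eq_of_isPushout
    ((IsPushout.of_hasPushout A.ι (SSet.stdSimplex.isTerminalObj₀.from (A : SSet.{u}))).map
      ((evaluation _ _).obj n)) y

lemma quotientMap_eq_basepoint {X : SSet.{u}} {A : X.Subcomplex} {n : SimplexCategoryᵒᵖ}
    (x : X.obj n) (hx : x ∈ A.obj n) :
    ∃ z, (quotientBasepoint X A).app n z = (quotientMap X A).app n x :=
  ⟨_, (ConcreteCategory.congr_hom (NatTrans.congr_app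
    (pushout.condition (f := A.ι)
      (g := SSet.stdSimplex.isTerminalObj₀.from (A : SSet.{u}))) n) ⟨x, hx⟩).symm⟩

/-- The quotient by the `1`-skeleton is `1`-reduced. -/
lemma isOneReduced_quotient (X : SSet.{u}) : isOneReduced (quotient X (skOne X)) := by
  have key : ∀ (n : ℕ) (_ : n < 2) (y : (quotient X (skOne X)) _⦋n⦌),
      ∃ z, (quotientBasepoint X (skOne X)).app _ z = y := by
    intro n hn y
    rcases quotient_cases y with ⟨x, rfl⟩ | h
    · exact quotientMap_eq_basepoint x (X.mem_skeleton x hn)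
    · exact h
  have sub : ∀ (n : ℕ) (_ : n < 2), Subsingleton ((quotient X (skOne X)) _⦋n⦌) := by
    intro n hn
    refine ⟨fun a b => ?_⟩
    obtain ⟨a', rfl⟩ := key n hn a
    obtain ⟨b', rfl⟩ := key n hn b
    have hab : a' = b' := ULift.ext _ _ (SimplexCategory.isTerminalZero.hom_ext _ _)
    rw [hab]
  have h0 := sub 0 (by norm_num)
  have h1 := sub 1 (by norm_num)
  exact ⟨(quotientBasepoint X (skOne X)).app _ (SSet.stdSimplex.obj₀Equiv.symm 0),
    fun y => Subsingleton.elim _ _, fun e => Subsingleton.elim _ _⟩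

/-- The simplicial map `X / sk_1 X → Y / sk_1 Y` induced by `f : X → Y`. -/
noncomputable def quotientSkOneMap {X Y : SSet.{u}} (f : X ⟶ Y) :
    quotient X (skOne X) ⟶ quotient Y (skOne Y) :=
  pushout.map _ _ _ _ f (𝟙 _) (skOneMap f) (skOneMap_ι f).symm
    (SSet.stdSimplex.isTerminalObj₀.hom_ext _ _)

lemma quotient_hom_ext {X Z : SSet.{u}} {A : X.Subcomplex} {f g : quotient X A ⟶ Z}
    (h₁ : quotientMap X A ≫ f = quotientMap X A ≫ g)
    (h₂ : quotientBasepoint X A ≫ f = quotientBasepoint X A ≫ g) : f = g :=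
  pushout.hom_ext h₁ h₂

lemma quotientMap_skOneMap {X Y : SSet.{u}} (f : X ⟶ Y) :
    quotientMap X (skOne X) ≫ quotientSkOneMap f = f ≫ quotientMap Y (skOne Y) :=
  pushout.inl_desc _ _ _

lemma quotientBasepoint_skOneMap {X Y : SSet.{u}} (f : X ⟶ Y) :
    quotientBasepoint X (skOne X) ≫ quotientSkOneMap f = quotientBasepoint Y (skOne Y) :=
  (pushout.inr_desc _ _ _).trans (Category.id_comp _)

/-- The `1`-reduction functor, `R_1(X) = X / sk_1(X)`. -/
noncomputable def oneReduction : SSet.{u} ⥤ SSetOne.{u} where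
  obj X := ⟨quotient X (skOne X), isOneReduced_quotient X⟩
  map f := ObjectProperty.homMk (quotientSkOneMap f)
  map_id X := by
    apply ObjectProperty.hom_ext
    change quotientSkOneMap (𝟙 X) = 𝟙 (quotient X (skOne X))
    apply quotient_hom_ext
    · rw [quotientMap_skOneMap, Category.id_comp, Category.comp_id]
    · rw [quotientBasepoint_skOneMap, Category.comp_id]
  map_comp f g := by
    apply ObjectProperty.hom_ext
    change quotientSkOneMap (f ≫ g) = quotientSkOneMap f ≫ quotientSkOneMap g
    apply quotient_hom_ext
    · rw [quotientMap_skOneMap, ← Category.assoc, quotientMap_skOneMap, Category.assoc,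
        Category.assoc, quotientMap_skOneMap]
    · rw [quotientBasepoint_skOneMap, ← Category.assoc, quotientBasepoint_skOneMap,
        quotientBasepoint_skOneMap]

/-- The simplicial `n`-sphere `Δ[n] / ∂Δ[n]`. -/
noncomputable def simplicialSphere (n : ℕ) : SSet.{u} := quotient Δ[n] (SSet.boundary n)

/-- The inclusion of the basepoint (the image of `∂Δ[n]`) of the simplicial `n`-sphere. -/
noncomputable def sphereBasepoint (n : ℕ) : Δ[0] ⟶ simplicialSphere.{u} n :=
  quotientBasepoint Δ[n] (SSet.boundary n)

/-! ### Kan fibrations, and the model structure on `1`-reduced simplicial sets -/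

/-- A Kan fibration: a simplicial map with the right lifting property with respect to all horn
inclusions `Λ[n, i] → Δ[n]`, `n ≥ 1`. -/
def IsKanFibration {X Y : SSet.{u}} (p : X ⟶ Y) : Prop :=
  ∀ (n : ℕ) (_ : 1 ≤ n) (i : Fin (n + 1)), HasLiftingProperty (SSet.horn.{u} n i).ι p

open HomotopicalAlgebra

/-- The cofibrations of `1`-reduced simplicial sets are the monomorphisms. -/
instance : CategoryWithCofibrations SSetOne.{u} where
  cofibrations := fun _ _ f => Mono (forgetToSSet.map f)

/-- The weak equivalences of `1`-reduced simplicial sets are the maps whose geometric realization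
is a weak homotopy equivalence. -/
instance : CategoryWithWeakEquivalences SSetOne.{u} where
  weakEquivalences := fun _ _ f =>
    IsWeakHomotopyEquiv (SSet.toTop.map (forgetToSSet.map f)).hom

/-- The fibrations of `1`-reduced simplicial sets are the maps with the right lifting property
with respect to all acyclic cofibrations of `1`-reduced simplicial sets. -/
instance : CategoryWithFibrations SSetOne.{u} where
  fibrations := (trivialCofibrations SSetOne.{u}).rlp

end OneReduced

/-!
The quotients are computed from the facts that horns of `Δ[2]` have dimension at most `1` and that
the `1`-skeleton of `Δ[2]` is its boundary. So the map in question is the base point of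
`S² = Δ[2]/∂Δ[2]`, and it is no Kan fibration because the quotient map `Δ[2] → S²`, which is
constant on horns, is not constant.

For the fibration property, let `A → B` be a weak equivalence of `1`-reduced simplicial sets and
`f : B → S²` a map that is constant on `A`. A lift exists as soon as `f` is constant, and this holds
if no `2`-simplex of `B` goes to the nondegenerate `2`-simplex `σ` of `S²`
(`eq_comp_sphereBasepoint`). Suppose that `b` goes to `σ`. As `B` is `1`-reduced, the characteristic
map of `b` collapses the boundary of the triangle to a point and defines an element of `π₂|B|`. This
element comes from `π₂|A|`, so it dies under every continuous map out of `|B|` that factors through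
`|f|` (`app_ne_sphereSimplex`). What is needed is therefore a space `T` and a map `S² → Sing T` that
sends `σ` to a triangle in `T` with nontrivial class in `π₂(T)`.

Take for `T` the idempotent operators on `ℂ²`, and for the triangle the projections to the lines
spanned by `s(t) = (p(t), t₀t₁t₂)`, where `p` maps the triangle affinely to a triangle in `ℂ` around
`0`. On the boundary this line is `ℂ × 0`. A homotopy to the constant map relative to the boundary
would give a nowhere vanishing section `z` of the line bundle over the square that is constant on
the boundary (`exists_section_of_homotopy`): over a short time interval, project the old section to
the new lines. Then `z = r s` with `r` nowhere zero, so `r` has a continuous logarithm on the square;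
but on the boundary `r = 1/p`, which winds around `0` (`not_homotopicRel_triangleMap`).
-/

namespace OneReduced

/-! ### Projections to lines and sections along homotopies -/

section Lines

variable {E : Type*} [NormedAddCommGroup E] [InnerProductSpace ℂ E]

/-- The orthogonal projection of `E` onto the line spanned by `s`; it is `0` if `s = 0`. -/
noncomputable def lineProjection (s : E) : E →L[ℂ] E :=
  ((‖s‖ : ℂ) ^ 2)⁻¹ • InnerProductSpace.rankOne ℂ s s

lemma lineProjection_apply (s v : E) :
    lineProjection s v = (((‖s‖ : ℂ) ^ 2)⁻¹ * inner ℂ s v) • s := by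
  simp [lineProjection, smul_smul]

lemma lineProjection_self (s : E) : lineProjection s s = s := by
  rcases eq_or_ne s 0 with rfl | hs
  · simp
  · have : (‖s‖ : ℂ) ≠ 0 := by simpa using hs
    rw [lineProjection_apply, inner_self_eq_norm_sq_to_K]
    simp [this]

lemma isIdempotentElem_lineProjection (s : E) : IsIdempotentElem (lineProjection s) := by
  ext v
  change lineProjection s (lineProjection s v) = _
  rw [lineProjection_apply s v, map_smul, lineProjection_self]

lemma lineProjection_smul (c : ℂ) (hc : c ≠ 0) (s : E) :
    lineProjection (c • s) = lineProjection s := by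
  rcases eq_or_ne s 0 with rfl | hs
  · simp
  ext v
  have hs' : (‖s‖ : ℂ) ≠ 0 := by simpa using hs
  have hn : (‖c‖ : ℂ) ≠ 0 := by simpa using hc
  rw [lineProjection_apply, lineProjection_apply, smul_smul, norm_smul, inner_smul_left]
  congr 1
  have : (starRingEnd ℂ) c * c = (‖c‖ : ℂ) ^ 2 := Complex.conj_mul' c
  push_cast
  field_simp
  linear_combination (inner ℂ s v) * this

lemma continuous_lineProjection {X : Type*} [TopologicalSpace X] {s : X → E} (hs : Continuous s)
    (h0 : ∀ x, s x ≠ 0) : Continuous fun x => lineProjection (s x) := by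
  have hn : Continuous fun x => ((‖s x‖ : ℂ) ^ 2) := by fun_prop
  refine Continuous.smul (hn.inv₀ fun x => ?_) ?_
  · simpa using h0 x
  · exact ((ContinuousLinearMap.smulRightL ℂ E E).continuous.comp
      ((innerSL ℂ).continuous.comp hs)).clm_apply hs

end Lines

/-- A homotopy of idempotent operators, parametrised by a compact space, moves sections of the
images along with it. -/
lemma exists_section_of_homotopy {X E : Type*} [TopologicalSpace X] [CompactSpace X]
    [NormedAddCommGroup E] [NormedSpace ℂ E] (H : C(unitInterval, C(X, E →L[ℂ] E)))
    (hH : ∀ t x, IsIdempotentElem (H t x)) (S : Set X) (v : E) (hv : v ≠ 0)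
    (hS : ∀ t, ∀ x ∈ S, H t x v = v) (h1 : ∀ x, H 1 x v = v) :
    ∃ z : C(X, E), ∀ x, H 0 x (z x) = z x ∧ z x ≠ 0 ∧ (x ∈ S → z x = v) := by
  let Q : unitInterval → Prop := fun t =>
    ∃ z : C(X, E), ∀ x, H t x (z x) = z x ∧ z x ≠ 0 ∧ (x ∈ S → z x = v)
  -- Over a short interval, applying the new idempotents to the old section keeps it nonzero.
  have step : ∀ s t, dist (H s) (H t) < 1 → Q s → Q t := by
    rintro s t hst ⟨z, hz⟩
    refine ⟨⟨fun x => H t x (z x), by fun_prop⟩, fun x => ⟨?_, fun h0 => ?_, fun hx => ?_⟩⟩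
    · exact congrArg (fun P : E →L[ℂ] E => P (z x)) (hH t x)
    · have hpos : 0 < ‖z x‖ := norm_pos_iff.2 (hz x).2.1
      replace h0 : H t x (z x) = 0 := h0
      have h2 : z x = (H s x - H t x) (z x) := by
        rw [sub_apply, h0, (hz x).1, sub_zero]
      have h3 : ‖z x‖ ≤ ‖H s x - H t x‖ * ‖z x‖ := by
        conv_lhs => rw [h2]
        exact ContinuousLinearMap.le_opNorm _ _
      have h4 : ‖H s x - H t x‖ < 1 := by
        rw [← dist_eq_norm]
        exact (ContinuousMap.dist_apply_le_dist x).trans_lt hst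
      nlinarith
    · change H t x (z x) = v
      rw [(hz x).2.2 hx, hS t x hx]
  have key : Q 1 → Q 0 := by
    refine PreconnectedSpace.induction₂' (fun s t => Q s → Q t) (fun s => ?_)
      ⟨fun a b c h h' => h' ∘ h⟩ 1 0
    filter_upwards [(H.continuous.tendsto s) (Metric.ball_mem_nhds (H s) one_pos)] with t ht
    exact ⟨step s t (by rw [dist_comm]; exact ht), step t s ht⟩
  exact key ⟨.const X v, fun x => ⟨h1 x, hv, fun _ => rfl⟩⟩

/-! ### Continuous logarithms -/

/-- A nowhere vanishing complex function on a cube has a continuous logarithm. -/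
lemma exists_continuous_log {n : ℕ} (f : C(Fin n → unitInterval, ℂ)) (hf : ∀ x, f x ≠ 0) :
    ∃ L : C(Fin n → unitInterval, ℂ), ∀ x, Complex.exp (L x) = f x := by
  -- Clamp coordinates to extend `f` to `ℝⁿ`, which is simply connected.
  let r : C(Fin n → ℝ, Fin n → unitInterval) :=
    ⟨fun x i => Set.projIcc 0 1 zero_le_one (x i),
      continuous_pi fun i => continuous_projIcc.comp (continuous_apply i)⟩
  obtain ⟨F, ⟨-, hF⟩, -⟩ := Complex.isCoveringMapOn_exp.existsUnique_continuousMap_lifts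
    (f.comp r) (a₀ := 0) (e₀ := Complex.log (f (r 0))) (Complex.exp_log (hf _)) (fun a => hf _)
  refine ⟨F.comp ⟨fun x i => (x i : ℝ), by fun_prop⟩, fun x => ?_⟩
  refine (congrFun hF _).trans (congrArg f ?_)
  funext i
  exact Set.projIcc_val zero_le_one (x i)

/-- The change of a continuous logarithm along the segment from `k` to `k * w`. -/
lemma log_sub_log_of_segment (L : C(unitInterval, ℂ)) (k w : ℂ)
    (hw : ∀ s : unitInterval, (1 - s : ℂ) + s * w ∈ Complex.slitPlane)
    (hL : ∀ s : unitInterval, Complex.exp (L s) = k * ((1 - s : ℂ) + s * w)) :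
    L 1 - L 0 = Complex.log w := by
  have := Complex.isCoveringMap_exp.const_of_comp (A := unitInterval)
    (g := fun s => L s - Complex.log ((1 - s : ℂ) + s * w))
    (L.continuous.sub (Continuous.clog (by fun_prop) hw)) (fun a b => by
      apply Subtype.ext
      have h (s) := Complex.slitPlane_ne_zero (hw s)
      simp only [Complex.exp_sub, hL, Complex.exp_log (h _)]
      rw [mul_div_cancel_right₀ _ (h a), mul_div_cancel_right₀ _ (h b)]) 0 1
  simp at this
  linear_combination -this
/-! ### An essential map from the triangle modulo its boundary -/

/-- A primitive cube root of unity; `1`, `ω`, `ω²` are the vertices of a triangle around `0`. -/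
noncomputable def ω : ℂ := ⟨-1 / 2, √3 / 2⟩

lemma ω_sq : ω ^ 2 = ⟨-1 / 2, -(√3 / 2)⟩ := by
  have : √3 * √3 = 3 := Real.mul_self_sqrt (by norm_num)
  apply Complex.ext <;> simp [ω, pow_two] <;> linarith

lemma ω_cube : ω ^ 3 = 1 := by
  have : √3 * √3 = 3 := Real.mul_self_sqrt (by norm_num)
  rw [pow_succ, ω_sq]
  apply Complex.ext <;> simp [ω] <;> linarith

lemma ω_ne_one : ω ≠ 1 := by
  intro h
  have := congrArg Complex.re h
  norm_num [ω] at this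

lemma segment_ω_mem_slitPlane (s : unitInterval) : (1 - s : ℂ) + s * ω ∈ Complex.slitPlane := by
  rw [Complex.mem_slitPlane_iff]
  rcases eq_or_ne s 0 with rfl | hs
  · left; simp
  · right
    have : (s : ℝ) ≠ 0 := by simpa using hs
    simp [ω, this]

/-- The affine map from the triangle to `ℂ` with vertices `1`, `ω`, `ω²`. -/
noncomputable def trianglePlane (t : stdSimplex ℝ (Fin 3)) : ℂ := t 0 + t 1 * ω + t 2 * ω ^ 2

lemma trianglePlane_ne_zero (t : stdSimplex ℝ (Fin 3)) (h : t 0 * t 1 * t 2 = 0) :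
    trianglePlane t ≠ 0 := by
  intro h0
  have hs : t 0 + t 1 + t 2 = 1 := by
    rw [← stdSimplex.sum_eq_one t, Fin.sum_univ_three]
  have h3 : √3 ≠ 0 := by simp
  have hre := congrArg Complex.re h0
  have him := congrArg Complex.im h0
  rw [trianglePlane, ω_sq] at hre him
  simp [ω] at hre him
  have h12 : t 1 = t 2 := mul_right_cancel₀ h3 (by linarith)
  have h1 : t 1 = 1 / 3 := by linarith
  have h2 : t 2 = 1 / 3 := by linarith
  have h00 : t 0 = 1 / 3 := by linarith
  rw [h00, h1, h2] at h
  norm_num at h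

/-- A nowhere vanishing map from the triangle to `ℂ²`. It spans the line `ℂ × 0` along the boundary,
around which its first coordinate winds once. -/
noncomputable def triangleSection (t : stdSimplex ℝ (Fin 3)) : EuclideanSpace ℂ (Fin 2) :=
  !₂[trianglePlane t, ((t 0 * t 1 * t 2 : ℝ) : ℂ)]

lemma triangleSection_ne_zero (t : stdSimplex ℝ (Fin 3)) : triangleSection t ≠ 0 := by
  intro h
  have h0 : trianglePlane t = 0 := congrArg (fun v : EuclideanSpace ℂ (Fin 2) => v 0) h
  have h1 : ((t 0 * t 1 * t 2 : ℝ) : ℂ) = 0 :=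
    congrArg (fun v : EuclideanSpace ℂ (Fin 2) => v 1) h
  exact trianglePlane_ne_zero t (by exact_mod_cast h1) h0

lemma continuous_coord (i : Fin 3) : Continuous fun t : stdSimplex ℝ (Fin 3) => t i :=
  (continuous_apply i).comp continuous_subtype_val

lemma continuous_triangleSection : Continuous triangleSection := by
  have h0 := continuous_coord 0
  have h1 := continuous_coord 1
  have h2 := continuous_coord 2
  refine (PiLp.continuous_toLp 2 _).comp (continuous_pi fun i => ?_)
  fin_cases i
  · change Continuous trianglePlane
    exact ((Complex.continuous_ofReal.comp h0).add
      ((Complex.continuous_ofReal.comp h1).mul_const _)).add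
      ((Complex.continuous_ofReal.comp h2).mul_const _)
  · change Continuous fun t : stdSimplex ℝ (Fin 3) => ((t 0 * t 1 * t 2 : ℝ) : ℂ)
    exact Complex.continuous_ofReal.comp ((h0.mul h1).mul h2)

/-- The first basis vector of `ℂ²`. -/
noncomputable def firstBasisVector : EuclideanSpace ℂ (Fin 2) := !₂[1, 0]

lemma triangleSection_boundary (t : stdSimplex ℝ (Fin 3)) (h : t 0 * t 1 * t 2 = 0) :
    triangleSection t = trianglePlane t • firstBasisVector := by
  ext i
  fin_cases i <;> simp [triangleSection, firstBasisVector, h]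

/-- The space of idempotent operators on `ℂ²`. It contains the complex projective line, as the space
of orthogonal projections of rank one. -/
abbrev Idempotents : Type :=
  {P : EuclideanSpace ℂ (Fin 2) →L[ℂ] EuclideanSpace ℂ (Fin 2) // IsIdempotentElem P}

/-- The base point of `Idempotents`: the projection to the line `ℂ × 0`. -/
noncomputable def basePoint : Idempotents :=
  ⟨lineProjection firstBasisVector, isIdempotentElem_lineProjection _⟩

/-- The map from the triangle to the projective line that sends `t` to the line spanned by
`triangleSection t`; it collapses the boundary to a point. -/
noncomputable def triangleMap : C(stdSimplex ℝ (Fin 3), Idempotents) :=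
  ⟨fun t => ⟨lineProjection (triangleSection t), isIdempotentElem_lineProjection _⟩,
    (continuous_lineProjection continuous_triangleSection triangleSection_ne_zero).subtype_mk _⟩

lemma triangleMap_boundary (t : stdSimplex ℝ (Fin 3)) (h : t 0 * t 1 * t 2 = 0) :
    triangleMap t = basePoint := by
  apply Subtype.ext
  change lineProjection (triangleSection t) = lineProjection firstBasisVector
  rw [triangleSection_boundary t h, lineProjection_smul _ (trianglePlane_ne_zero t h)]

/-- The map from the square to the triangle given by polar coordinates around the vertex `0`. -/
def squareToTriangle : C(Fin 2 → unitInterval, stdSimplex ℝ (Fin 3)) where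
  toFun y := ⟨![1 - y 0, y 0 * (1 - y 1), y 0 * y 1], by
    have h0 := (y 0).2.1
    have h0' := (y 0).2.2
    have h1 := (y 1).2.1
    have h1' := (y 1).2.2
    constructor
    · intro i
      fin_cases i
      · simpa using h0'
      · exact mul_nonneg h0 (by simpa using h1')
      · exact mul_nonneg h0 h1
    · simp [Fin.sum_univ_three]
      ring⟩
  continuous_toFun := by
    refine Continuous.subtype_mk (continuous_pi fun i => ?_) _
    fin_cases i
    · change Continuous fun y : Fin 2 → unitInterval => 1 - (y 0 : ℝ)
      fun_prop
    · change Continuous fun y : Fin 2 → unitInterval => (y 0 : ℝ) * (1 - (y 1 : ℝ))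
      fun_prop
    · change Continuous fun y : Fin 2 → unitInterval => (y 0 : ℝ) * (y 1 : ℝ)
      fun_prop

lemma squareToTriangle_apply (y : Fin 2 → unitInterval) :
    squareToTriangle y 0 = 1 - y 0 ∧ squareToTriangle y 1 = y 0 * (1 - y 1) ∧
      squareToTriangle y 2 = y 0 * y 1 := ⟨rfl, rfl, rfl⟩

lemma squareToTriangle_boundary (y : Fin 2 → unitInterval) (hy : y ∈ Cube.boundary (Fin 2)) :
    squareToTriangle y 0 * squareToTriangle y 1 * squareToTriangle y 2 = 0 := by
  obtain ⟨h0, h1, h2⟩ := squareToTriangle_apply y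
  rw [h0, h1, h2]
  obtain ⟨i, hi⟩ := hy
  fin_cases i <;> rcases hi with hi | hi <;> simp at hi <;> simp [hi]

/-- The map `trianglePlane` has no logarithm along the boundary of the square: on the sides that map
to the three edges of the triangle a logarithm would grow by `log ω` each, and on the fourth side,
which maps to a vertex, not at all, so that going around once would give `3 log ω = 0`. -/
lemma no_log_trianglePlane (L : C(Fin 2 → unitInterval, ℂ))
    (hL : ∀ y ∈ Cube.boundary (Fin 2),
      Complex.exp (L y) = trianglePlane (squareToTriangle y)) : False := by
  have h01 := log_sub_log_of_segment (L.comp ⟨fun s => ![s, 0], by fun_prop⟩) 1 ω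
    segment_ω_mem_slitPlane (fun s => by
      change Complex.exp (L ![s, 0]) = _
      rw [hL _ ⟨1, by simp⟩]
      simp [trianglePlane, squareToTriangle_apply])
  have h12 := log_sub_log_of_segment (L.comp ⟨fun s => ![1, s], by fun_prop⟩) ω ω
    segment_ω_mem_slitPlane (fun s => by
      change Complex.exp (L ![1, s]) = _
      rw [hL _ ⟨0, by simp⟩]
      simp [trianglePlane, squareToTriangle_apply]
      ring)
  have h20 := log_sub_log_of_segment (L.comp ⟨fun s => ![unitInterval.symm s, 1], by fun_prop⟩)
    (ω ^ 2) ω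
    segment_ω_mem_slitPlane (fun s => by
      change Complex.exp (L ![unitInterval.symm s, 1]) = _
      rw [hL _ ⟨1, by simp⟩]
      simp [trianglePlane, squareToTriangle_apply]
      linear_combination (-(s : ℂ)) * ω_cube)
  have h00 := log_sub_log_of_segment (L.comp ⟨fun s => ![0, s], by fun_prop⟩) 1 1
    (fun s => by simp) (fun s => by
      change Complex.exp (L ![0, s]) = _
      rw [hL _ ⟨0, by simp⟩]
      simp [trianglePlane, squareToTriangle_apply])
  simp at h01 h12 h20 h00
  have h3 : Complex.log ω = 0 := by linear_combination (-h01 - h12 - h20 + h00) / 3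
  have hω : ω ≠ 0 := fun h => by simpa [h] using ω_cube
  apply ω_ne_one
  rw [← Complex.exp_log hω, h3, Complex.exp_zero]

/-- Collapsing the boundary of the triangle, `triangleMap` defines a nontrivial element of the second
homotopy group of the projective line. -/
theorem not_homotopicRel_triangleMap :
    ¬ (triangleMap.comp squareToTriangle).HomotopicRel (.const _ basePoint)
      (Cube.boundary (Fin 2)) := by
  rintro ⟨H⟩
  have hb : ∀ t, ∀ y ∈ Cube.boundary (Fin 2), H (t, y) = basePoint := fun t y hy =>
    (H.prop t y hy).trans (triangleMap_boundary _ (squareToTriangle_boundary y hy))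
  have he : (basePoint : _ →L[ℂ] _) firstBasisVector = firstBasisVector := lineProjection_self _
  obtain ⟨z, hz⟩ := exists_section_of_homotopy
    (ContinuousMap.curry ⟨fun x => (H x : EuclideanSpace ℂ (Fin 2) →L[ℂ] _), by fun_prop⟩)
    (fun t y => (H (t, y)).2) (Cube.boundary (Fin 2)) firstBasisVector (fun h => by
      simpa [firstBasisVector] using congrArg (fun v : EuclideanSpace ℂ (Fin 2) => v 0) h)
    (fun t y hy => by
      change (H (t, y) : EuclideanSpace ℂ (Fin 2) →L[ℂ] _) firstBasisVector = firstBasisVector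
      rw [hb t y hy, he])
    (fun y => by
      change (H (1, y) : EuclideanSpace ℂ (Fin 2) →L[ℂ] _) firstBasisVector = firstBasisVector
      rw [H.apply_one]
      exact he)
  -- `z` is a multiple of `triangleSection`. The ratio `r` vanishes nowhere, and on the boundary it is
  -- the inverse of `trianglePlane`.
  let s : C(Fin 2 → unitInterval, EuclideanSpace ℂ (Fin 2)) :=
    ⟨fun y => triangleSection (squareToTriangle y), by
      exact continuous_triangleSection.comp squareToTriangle.continuous⟩
  have hs0 : ∀ y, ((‖s y‖ : ℂ) ^ 2) ≠ 0 := fun y => by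
    exact pow_ne_zero 2 (Complex.ofReal_ne_zero.2 (norm_ne_zero_iff.2 (triangleSection_ne_zero _)))
  have hnorm : Continuous fun y => ((‖s y‖ : ℂ) ^ 2) := by fun_prop
  let r : C(Fin 2 → unitInterval, ℂ) :=
    ⟨fun y => ((‖s y‖ : ℂ) ^ 2)⁻¹ * inner ℂ (s y) (z y),
      (hnorm.inv₀ hs0).mul (by fun_prop)⟩
  have hr : ∀ y, z y = r y • s y := fun y => by
    have h := (hz y).1
    change (H (0, y) : EuclideanSpace ℂ (Fin 2) →L[ℂ] _) (z y) = z y at h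
    rw [H.apply_zero] at h
    exact h.symm.trans (lineProjection_apply _ _)
  have hr0 : ∀ y, r y ≠ 0 := fun y h => (hz y).2.1 (by rw [hr, h, zero_smul])
  obtain ⟨L, hL⟩ := exists_continuous_log r hr0
  refine no_log_trianglePlane (-L) fun y hy => ?_
  have h1 : firstBasisVector = r y • s y := ((hz y).2.2 hy).symm.trans (hr y)
  have h2 : (1 : ℂ) = r y * trianglePlane (squareToTriangle y) :=
    congrArg (fun v : EuclideanSpace ℂ (Fin 2) => v 0) h1
  change Complex.exp (-(L y)) = _
  rw [Complex.exp_neg, hL]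
  exact (eq_inv_of_mul_eq_one_right h2.symm).symm

/-! ### Faces of topological simplices and characteristic maps -/

lemma stdSimplex_map_apply_of_notMem_range {X Y : Type*} [Fintype X] [Fintype Y]
    (f : X → Y) (t : stdSimplex ℝ X) (j : Y) (hj : j ∉ Set.range f) : stdSimplex.map f t j = 0 := by
  classical
  change FunOnFinite.linearMap ℝ ℝ f t j = 0
  rw [FunOnFinite.linearMap_apply_apply]
  refine Finset.sum_eq_zero fun i hi => (hj ⟨i, ?_⟩).elim
  simpa using hi

lemma stdSimplex_map_apply_of_injective {X Y : Type*} [Fintype X] [Fintype Y]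
    (f : X → Y) (hf : Function.Injective f) (t : stdSimplex ℝ X) (i : X) :
    stdSimplex.map f t (f i) = t i := by
  classical
  change FunOnFinite.linearMap ℝ ℝ f t (f i) = t i
  rw [FunOnFinite.linearMap_apply_apply, Finset.sum_eq_single_of_mem i (by simp)]
  intro k hk hki
  exact (hki (hf (by simpa using hk))).elim

/-- A point of a simplex with a vanishing coordinate lies in the opposite face. -/
lemma exists_stdSimplex_map_succAbove {n : ℕ} (t : stdSimplex ℝ (Fin (n + 1))) (i : Fin (n + 1))
    (hi : t i = 0) : ∃ u : stdSimplex ℝ (Fin n), stdSimplex.map i.succAbove u = t := by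
  refine ⟨⟨fun k => t (i.succAbove k), fun k => stdSimplex.zero_le t _, ?_⟩, ?_⟩
  · have := stdSimplex.sum_eq_one t
    rwa [Fin.sum_univ_succAbove _ i, hi, zero_add] at this
  · apply DFunLike.ext
    intro j
    rcases Fin.eq_self_or_eq_succAbove i j with rfl | ⟨k, rfl⟩
    · rw [stdSimplex_map_apply_of_notMem_range _ _ _ (by simp), hi]
    · rw [stdSimplex_map_apply_of_injective _ Fin.succAbove_right_injective]
      rfl

section Singular

variable {Y Z : TopCat.{u}}

lemma toSSetObjEquiv_map {m n : SimplexCategoryᵒᵖ} (f : m ⟶ n) (x : (TopCat.toSSet.obj Y).obj m)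
    (t : stdSimplex ℝ (Fin (n.unop.len + 1))) :
    TopCat.toSSetObjEquiv Y n ((TopCat.toSSet.obj Y).map f x) t =
      TopCat.toSSetObjEquiv Y m x (stdSimplex.map f.unop t) := rfl

lemma toSSetObjEquiv_app (g : Y ⟶ Z) {n : SimplexCategoryᵒᵖ} (x : (TopCat.toSSet.obj Y).obj n)
    (t : stdSimplex ℝ (Fin (n.unop.len + 1))) :
    TopCat.toSSetObjEquiv Z n ((TopCat.toSSet.map g).app n x) t =
      g (TopCat.toSSetObjEquiv Y n x t) := rfl

end Singular

/-- The unit `X ⟶ Sing |X|` of the adjunction between realization and singular complex. -/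
noncomputable def toSingular (X : SSet.{u}) : X ⟶ TopCat.toSSet.obj (SSet.toTop.obj X) :=
  sSetTopAdj.unit.app X

lemma toSingular_map {X : SSet.{u}} {m n : SimplexCategoryᵒᵖ} (f : m ⟶ n) (x : X.obj m) :
    (toSingular X).app n (X.map f x) =
      (TopCat.toSSet.obj (SSet.toTop.obj X)).map f ((toSingular X).app m x) := by
  exact NatTrans.naturality_apply (toSingular X) f x

lemma toSingular_naturality {X Y : SSet.{u}} (f : X ⟶ Y) :
    f ≫ toSingular Y = toSingular X ≫ TopCat.toSSet.map (SSet.toTop.map f) :=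
  sSetTopAdj.unit.naturality f

lemma toSingular_app {X Y : SSet.{u}} (f : X ⟶ Y) {n : SimplexCategoryᵒᵖ} (x : X.obj n) :
    (toSingular Y).app n (f.app n x) =
      (TopCat.toSSet.map (SSet.toTop.map f)).app n ((toSingular X).app n x) := by
  have h := NatTrans.congr_app (toSingular_naturality f) n
  exact ConcreteCategory.congr_hom h x

/-- The characteristic map `Δⁿ → |X|` of an `n`-simplex of `X`. -/
noncomputable def characteristicMap {X : SSet.{u}} {n : SimplexCategoryᵒᵖ} (x : X.obj n) :
    C(stdSimplex ℝ (Fin (n.unop.len + 1)), SSet.toTop.obj X) :=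
  TopCat.toSSetObjEquiv _ n ((toSingular X).app n x)

lemma characteristicMap_map {X : SSet.{u}} {m n : SimplexCategoryᵒᵖ} (f : m ⟶ n) (x : X.obj m)
    (t : stdSimplex ℝ (Fin (n.unop.len + 1))) :
    characteristicMap (X.map f x) t = characteristicMap x (stdSimplex.map f.unop t) := by
  rw [characteristicMap, toSingular_map, toSSetObjEquiv_map, characteristicMap]

lemma characteristicMap_app {X Y : SSet.{u}} (f : X ⟶ Y) {n : SimplexCategoryᵒᵖ} (x : X.obj n)
    (t : stdSimplex ℝ (Fin (n.unop.len + 1))) :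
    characteristicMap (f.app n x) t = SSet.toTop.map f (characteristicMap x t) := by
  rw [characteristicMap, toSingular_app, toSSetObjEquiv_app, characteristicMap]

lemma homEquiv_symm_characteristicMap {X : SSet.{u}} {Y : TopCat.{u}} (f : X ⟶ TopCat.toSSet.obj Y)
    {n : SimplexCategoryᵒᵖ} (x : X.obj n) (t : stdSimplex ℝ (Fin (n.unop.len + 1))) :
    (sSetTopAdj.homEquiv X Y).symm f (characteristicMap x t) =
      TopCat.toSSetObjEquiv Y n (f.app n x) t := by
  obtain ⟨g, rfl⟩ := (sSetTopAdj.homEquiv X Y).surjective f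
  rw [Equiv.symm_apply_apply, Adjunction.homEquiv_unit]
  rfl

instance : Subsingleton (SSet.toTop.{u}.obj Δ[0]) := by
  have e := TopCat.homeoOfIso (SSet.toTopSimplex.{u}.app ⦋0⦌)
  have : Subsingleton (SimplexCategory.toTop.{u}.obj ⦋0⦌) := inferInstance
  exact e.injective.subsingleton

/-- In a `1`-reduced simplicial set, the characteristic map of a `2`-simplex collapses the boundary
of the triangle to the vertex. -/
lemma characteristicMap_boundary {X : SSet.{u}} {x : X _⦋0⦌} (hx : ∀ e : X _⦋1⦌, e = X.σ 0 x)
    (b : X _⦋2⦌) (t : stdSimplex ℝ (Fin 3)) (ht : t 0 * t 1 * t 2 = 0) :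
    characteristicMap b t = characteristicMap x (default : stdSimplex ℝ (Fin 1)) := by
  obtain ⟨i, hi⟩ : ∃ i, t i = 0 := by
    rcases mul_eq_zero.1 ht with h | h
    · rcases mul_eq_zero.1 h with h | h
      exacts [⟨0, h⟩, ⟨1, h⟩]
    · exact ⟨2, h⟩
  obtain ⟨u, rfl⟩ := exists_stdSimplex_map_succAbove t i hi
  refine (characteristicMap_map (SimplexCategory.δ i).op b u).symm.trans ?_
  rw [show X.map (SimplexCategory.δ i).op b = X.σ 0 x from hx _]
  refine (characteristicMap_map (SimplexCategory.σ 0).op x u).trans ?_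
  exact congrArg _ (Subsingleton.elim (α := stdSimplex ℝ (Fin 1)) _ _)

/-- The loop `I² → Δ² → |X|` that represents the element of `π₂` given by a `2`-simplex of a
`1`-reduced simplicial set. -/
noncomputable def simplexLoop {X : SSet.{u}} {x : X _⦋0⦌} (hx : ∀ e : X _⦋1⦌, e = X.σ 0 x)
    (b : X _⦋2⦌) :
    GenLoop (Fin 2) (SSet.toTop.obj X) (characteristicMap x (default : stdSimplex ℝ (Fin 1))) :=
  ⟨(characteristicMap b).comp squareToTriangle, fun y hy =>
    characteristicMap_boundary hx b _ (squareToTriangle_boundary y hy)⟩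

/-! ### Simplicial maps to the sphere -/

/-- The space `Idempotents`, lifted to an arbitrary universe. -/
noncomputable abbrev idempotentsTop : TopCat.{u} := TopCat.of (ULift.{u} Idempotents)

/-- `triangleMap` as a singular simplex. -/
noncomputable def singularTriangle : (TopCat.toSSet.obj idempotentsTop.{u}) _⦋2⦌ :=
  (TopCat.toSSetObjEquiv idempotentsTop (op ⦋2⦌)).symm
    ((ContinuousMap.mk ULift.up continuous_uliftUp).comp triangleMap)

/-- `basePoint` as a singular vertex. -/
noncomputable def singularBasePoint : (TopCat.toSSet.obj idempotentsTop.{u}) _⦋0⦌ :=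
  (TopCat.toSSetObjEquiv idempotentsTop (op ⦋0⦌)).symm (.const _ (ULift.up basePoint))

/-- The simplicial map from `S²` to the singular complex of the projective line that sends the
nondegenerate `2`-simplex to `triangleMap`. -/
noncomputable def sphereToSingular :
    simplicialSphere.{u} 2 ⟶ TopCat.toSSet.obj idempotentsTop.{u} :=
  pushout.desc (SSet.yonedaEquiv.symm singularTriangle) (SSet.yonedaEquiv.symm singularBasePoint) (by
    ext n ⟨x, hx⟩
    apply (TopCat.toSSetObjEquiv idempotentsTop n).injective
    ext1 t
    obtain ⟨j, hj⟩ := not_forall.1 hx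
    change ULift.up (triangleMap (stdSimplex.map (SSet.stdSimplex.asOrderHom x) t)) =
      ULift.up basePoint
    rw [triangleMap_boundary]
    have h0 := stdSimplex_map_apply_of_notMem_range (SSet.stdSimplex.asOrderHom x) t j hj
    fin_cases j <;> simp at h0 <;> simp [h0])

/-- The nondegenerate `2`-simplex of `S²`. -/
noncomputable def sphereSimplex : (simplicialSphere.{u} 2) _⦋2⦌ :=
  (quotientMap Δ[2] (SSet.boundary 2)).app _ (SSet.stdSimplex.objEquiv.symm (𝟙 _))

lemma sphereToSingular_sphereSimplex :
    sphereToSingular.app _ sphereSimplex.{u} = singularTriangle := by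
  have h : quotientMap Δ[2] (SSet.boundary 2) ≫ sphereToSingular =
    SSet.yonedaEquiv.symm singularTriangle.{u} := pushout.inl_desc _ _ _
  refine (ConcreteCategory.congr_hom (NatTrans.congr_app h (op ⦋2⦌))
    (SSet.stdSimplex.objEquiv.symm (𝟙 _))).trans ?_
  exact SSet.yonedaEquiv.apply_symm_apply singularTriangle

lemma sphereToSingular_basepoint :
    sphereBasepoint 2 ≫ sphereToSingular = SSet.yonedaEquiv.symm singularBasePoint.{u} :=
  pushout.inr_desc _ _ _

/-- A map to `S²` that is constant on `A` along a weak equivalence `A → B` avoids the nondegenerate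
`2`-simplex. Otherwise a `2`-simplex of `B` over it would give an element of `π₂|B|`, coming from
`π₂|A|`, with nontrivial image in `π₂` of the projective line. -/
theorem app_ne_sphereSimplex {A B : SSet.{u}} (hA : isOneReduced A) (hB : isOneReduced B)
    (i : A ⟶ B) (hi : IsWeakHomotopyEquiv (SSet.toTop.map i).hom)
    (f : B ⟶ simplicialSphere.{u} 2)
    (hf : i ≫ f = SSet.stdSimplex.isTerminalObj₀.from A ≫ sphereBasepoint 2) (b : B _⦋2⦌) :
    f.app _ b ≠ sphereSimplex := by
  intro hb
  obtain ⟨a, -, -⟩ := hA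
  obtain ⟨x, hx0, hx⟩ := hB
  obtain rfl : i.app _ a = x := hx0 _
  let h : SSet.toTop.obj B ⟶ idempotentsTop.{u} :=
    (sSetTopAdj.homEquiv _ _).symm (f ≫ sphereToSingular)
  let k : SSet.toTop.obj Δ[0] ⟶ idempotentsTop.{u} :=
    (sSetTopAdj.homEquiv _ _).symm (sphereBasepoint 2 ≫ sphereToSingular)
  have hik : SSet.toTop.map i ≫ h = SSet.toTop.map (SSet.stdSimplex.isTerminalObj₀.from A) ≫ k := by
    rw [← Adjunction.homEquiv_naturality_left_symm, ← Adjunction.homEquiv_naturality_left_symm,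
      ← Category.assoc, hf, Category.assoc]
  have hconst : ∀ z z', h (SSet.toTop.map i z) = h (SSet.toTop.map i z') := fun z z' => by
    have e := fun z => ConcreteCategory.congr_hom hik z
    refine (e z).trans (Eq.trans ?_ (e z').symm)
    exact congrArg k (Subsingleton.elim (α := SSet.toTop.{u}.obj Δ[0]) _ _)
  let a' := characteristicMap a (default : stdSimplex ℝ (Fin 1))
  have ha' : (SSet.toTop.map i).hom a' =
      characteristicMap (i.app _ a) (default : stdSimplex ℝ (Fin 1)) :=
    (characteristicMap_app i a _).symm
  let p : GenLoop (Fin 2) (SSet.toTop.obj B) ((SSet.toTop.map i).hom a') :=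
    ⟨(simplexLoop hx b).1, fun y hy => ((simplexLoop hx b).2 y hy).trans ha'.symm⟩
  obtain ⟨q, hq⟩ := (hi.2 2 one_le_two a').2 (Quotient.mk _ p)
  induction q using Quotient.inductionOn with | _ q
  have hqp : ContinuousMap.HomotopicRel (genLoopMap (SSet.toTop.map i).hom 2 a' q).1 p.1
    (Cube.boundary (Fin 2)) := Quotient.exact hq
  have hT := hqp.map fun H => H.compContinuousMap
    ((ContinuousMap.mk ULift.down continuous_uliftDown).comp h.hom)
  have h1 : ∀ y, h (p.1 y) = ULift.up (triangleMap (squareToTriangle y)) := fun y => by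
    refine (homEquiv_symm_characteristicMap (f ≫ sphereToSingular) b (squareToTriangle y)).trans ?_
    have : (f ≫ sphereToSingular).app _ b = singularTriangle :=
      (congrArg _ hb).trans sphereToSingular_sphereSimplex
    rw [this]
    rfl
  -- The image of the base point is read off at a boundary point of the square.
  have h0 : (0 : Fin 2 → unitInterval) ∈ Cube.boundary (Fin 2) := ⟨0, by simp⟩
  have h2 : h ((SSet.toTop.map i).hom a') = ULift.up basePoint := by
    rw [← p.2 0 h0]
    refine (h1 0).trans ?_
    rw [triangleMap_boundary _ (squareToTriangle_boundary _ h0)]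
  apply not_homotopicRel_triangleMap
  convert ContinuousMap.HomotopicRel.symm hT using 1
  · ext1 y
    exact (congrArg ULift.down (h1 y)).symm
  · ext1 y
    exact (congrArg ULift.down ((hconst (q.1 y) a').trans h2)).symm

/-! ### The `1`-reduction of the horn inclusions -/

lemma exists_quotient_iso_of_eq {X : SSet.{u}} {A B : X.Subcomplex} (h : A = B) :
    ∃ e : quotient X A ≅ quotient X B, quotientBasepoint X A ≫ e.hom = quotientBasepoint X B := by
  subst h
  exact ⟨Iso.refl _, Category.comp_id _⟩

lemma skOne_eq_top (X : SSet.{u}) [X.HasDimensionLT 2] : skOne X = ⊤ := by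
  rw [SSet.Subcomplex.eq_top_iff_of_hasDimensionLT _ 2]
  intro i hi x _
  exact X.mem_skeleton x hi

lemma isIso_quotientBasepoint {X : SSet.{u}} {A : X.Subcomplex} (h : A = ⊤) :
    IsIso (quotientBasepoint X A) := by
  subst h
  have : IsIso (⊤ : X.Subcomplex).ι := inferInstance
  exact (IsPushout.of_hasPushout (⊤ : X.Subcomplex).ι
    (SSet.stdSimplex.isTerminalObj₀.from _)).isIso_inr_of_isIso

lemma skOne_stdSimplex_two : skOne (Δ[2] : SSet.{u}) = SSet.boundary 2 := by
  apply le_antisymm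
  · refine iSup_le fun i => iSup_le fun x => ?_
    rw [SSet.Subcomplex.ofSimplex_le_iff, SSet.boundary_obj_eq_univ _ _ i.2]
    trivial
  · have h := skOne_eq_top (SSet.boundary.{u} 2 : SSet.{u})
    intro n x hx
    have hx' : (⟨x, hx⟩ : (SSet.boundary.{u} 2 : SSet.{u}).obj n) ∈
        (skOne (SSet.boundary.{u} 2 : SSet.{u})).obj n := by
      rw [h]
      trivial
    exact skeleton_le_preimage (SSet.boundary.{u} 2).ι 2 n hx'

/-- A simplicial map to `S²` that avoids the nondegenerate `2`-simplex is constant: any other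
simplex off the base point has that simplex as an iterated face. -/
lemma eq_comp_sphereBasepoint {B : SSet.{u}} (f : B ⟶ simplicialSphere.{u} 2)
    (hf : ∀ b : B _⦋2⦌, f.app _ b ≠ sphereSimplex) :
    f = SSet.stdSimplex.isTerminalObj₀.from B ≫ sphereBasepoint 2 := by
  ext n b
  suffices h : ∃ z, (sphereBasepoint 2).app n z = f.app n b by
    obtain ⟨z, hz⟩ := h
    refine hz.symm.trans (congrArg ((sphereBasepoint 2).app n) ?_)
    exact ULift.ext _ _ (SimplexCategory.isTerminalZero.hom_ext _ _)
  rcases quotient_cases (f.app n b) with ⟨x, hx⟩ | h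
  · by_cases hs : Function.Surjective (SSet.stdSimplex.asOrderHom x)
    · exfalso
      have : Epi (SSet.stdSimplex.objEquiv x) := SimplexCategory.epi_iff_surjective.2 hs
      have : IsSplitEpi (SSet.stdSimplex.objEquiv x) := isSplitEpi_of_epi _
      let s := section_ (SSet.stdSimplex.objEquiv x)
      apply hf (B.map s.op b)
      have h1 : f.app _ (B.map s.op b) = (simplicialSphere 2).map s.op (f.app n b) :=
        NatTrans.naturality_apply f s.op b
      rw [h1, ← hx]
      refine (NatTrans.naturality_apply (quotientMap Δ[2] (SSet.boundary 2)) s.op x).symm.trans ?_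
      refine congrArg ((quotientMap Δ[2] (SSet.boundary 2)).app _) ?_
      apply SSet.stdSimplex.objEquiv.injective
      exact IsSplitEpi.id (SSet.stdSimplex.objEquiv x)
    · obtain ⟨z, hz⟩ := quotientMap_eq_basepoint (A := SSet.boundary 2) x hs
      exact ⟨z, hz.trans hx⟩
  · exact h

/-- The nondegenerate `2`-simplex of `S²` is not a degeneracy of the base point: `sphereToSingular`
sends it to a nonconstant singular simplex. -/
lemma sphereBasepoint_app_ne (z : (Δ[0] : SSet.{u}) _⦋2⦌) :
    (sphereBasepoint 2).app _ z ≠ sphereSimplex := by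
  intro h
  have h1 : (SSet.yonedaEquiv.symm singularBasePoint.{u}).app _ z = singularTriangle := by
    rw [← sphereToSingular_basepoint, ← sphereToSingular_sphereSimplex, ← h]
    rfl
  apply not_homotopicRel_triangleMap
  have h2 : ∀ t, triangleMap t = basePoint := fun t =>
    (congrArg (fun x => (TopCat.toSSetObjEquiv idempotentsTop.{u} (op ⦋2⦌) x t).down) h1).symm
  have h3 : triangleMap.comp squareToTriangle = .const _ basePoint := by
    ext1 y
    exact h2 _
  rw [h3]
  exact ContinuousMap.HomotopicRel.refl _

end OneReduced

theorem mainTheorem9 (k : Fin 3) :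
    (∃ (e₁ : OneReduced.forgetToSSet.obj
            (OneReduced.oneReduction.obj (SSet.horn.{u} 2 k : SSet.{u})) ≅ Δ[0])
        (e₂ : OneReduced.forgetToSSet.obj
            (OneReduced.oneReduction.obj (Δ[2] : SSet.{u})) ≅ OneReduced.simplicialSphere.{u} 2),
        e₁.inv ≫ OneReduced.forgetToSSet.map (OneReduced.oneReduction.map (SSet.horn.{u} 2 k).ι) ≫
          e₂.hom = OneReduced.sphereBasepoint.{u} 2) ∧
      HomotopicalAlgebra.Fibration (OneReduced.oneReduction.map (SSet.horn.{u} 2 k).ι) ∧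
      ¬ OneReduced.IsKanFibration
        (OneReduced.forgetToSSet.map (OneReduced.oneReduction.map (SSet.horn.{u} 2 k).ι)) := by
  open OneReduced in
  have hiso : ∃ (e₁ : forgetToSSet.obj (oneReduction.obj (SSet.horn.{u} 2 k : SSet.{u})) ≅ Δ[0])
      (e₂ : forgetToSSet.obj (oneReduction.obj (Δ[2] : SSet.{u})) ≅ simplicialSphere.{u} 2),
      e₁.inv ≫ forgetToSSet.map (oneReduction.map (SSet.horn.{u} 2 k).ι) ≫ e₂.hom =
        sphereBasepoint.{u} 2 := by
    have := isIso_quotientBasepoint (skOne_eq_top (SSet.horn.{u} 2 k : SSet.{u}))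
    obtain ⟨e₂, he₂⟩ := exists_quotient_iso_of_eq skOne_stdSimplex_two.{u}
    refine ⟨(asIso (quotientBasepoint _ (skOne (SSet.horn.{u} 2 k : SSet.{u})))).symm, e₂, ?_⟩
    change quotientBasepoint _ _ ≫ quotientSkOneMap _ ≫ e₂.hom = _
    rw [← Category.assoc, quotientBasepoint_skOneMap]
    exact he₂
  refine ⟨hiso, ?_, ?_⟩
  all_goals obtain ⟨e₁, e₂, he⟩ := hiso
  · refine ⟨fun A B i hi => ⟨fun {top bot} sq => ?_⟩⟩
    let j := OneReduced.oneReduction.map (SSet.horn.{u} 2 k).ι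
    -- After the isomorphisms, `R₁(j)` is the base point, and the bottom map is constant.
    have hj : j.hom ≫ e₂.hom = e₁.hom ≫ OneReduced.sphereBasepoint 2 := by
      rw [← he, Iso.hom_inv_id_assoc]
      rfl
    have hw : i.hom ≫ bot.hom = top.hom ≫ j.hom :=
      (congrArg (fun f => f.hom) sq.w).symm
    have hf : i.hom ≫ bot.hom ≫ e₂.hom =
        SSet.stdSimplex.isTerminalObj₀.from A.obj ≫ OneReduced.sphereBasepoint 2 := by
      rw [← Category.assoc, hw, Category.assoc, hj, ← Category.assoc]
      congr 1
      exact SSet.stdSimplex.isTerminalObj₀.hom_ext _ _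
    have hb := OneReduced.eq_comp_sphereBasepoint _
      (OneReduced.app_ne_sphereSimplex A.property B.property i.hom hi.2 _ hf)
    refine ⟨⟨ObjectProperty.homMk (SSet.stdSimplex.isTerminalObj₀.from B.obj ≫ e₁.inv), ?_, ?_⟩⟩
    · apply ObjectProperty.hom_ext
      change i.hom ≫ _ ≫ e₁.inv = top.hom
      rw [← cancel_mono e₁.hom]
      exact SSet.stdSimplex.isTerminalObj₀.hom_ext _ _
    · apply ObjectProperty.hom_ext
      change (_ ≫ e₁.inv) ≫ j.hom = bot.hom
      rw [← cancel_mono e₂.hom, Category.assoc, Category.assoc, hj, Iso.inv_hom_id_assoc, ← hb]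
  · intro hK
    -- A lift for the quotient map `Δ[2] → S²` would make it constant.
    have := hK 2 one_le_two 0
    let q : (Δ[2] : SSet.{u}) ⟶ OneReduced.simplicialSphere 2 :=
      OneReduced.quotientMap Δ[2] (SSet.boundary 2)
    have hq : (SSet.horn.{u} 2 0).ι ≫ q =
        SSet.stdSimplex.isTerminalObj₀.from _ ≫ OneReduced.sphereBasepoint 2 :=
      OneReduced.eq_comp_sphereBasepoint _ fun b h => by
        obtain ⟨z, hz⟩ := OneReduced.quotientMap_eq_basepoint (A := SSet.boundary.{u} 2) b.1
          fun hs => b.2 (by rw [hs.range_eq, Set.univ_union])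
        exact OneReduced.sphereBasepoint_app_ne z (hz.trans h)
    have sq : CommSq (SSet.stdSimplex.isTerminalObj₀.from _ ≫ e₁.inv) (SSet.horn.{u} 2 0).ι
        (OneReduced.forgetToSSet.map (OneReduced.oneReduction.map (SSet.horn.{u} 2 k).ι))
        (q ≫ e₂.inv) := ⟨by
      rw [← cancel_mono e₂.hom]
      simp only [Category.assoc, Iso.inv_hom_id, Category.comp_id, he, hq]⟩
    have hl : q = (sq.lift ≫ e₁.hom) ≫ OneReduced.sphereBasepoint 2 := by
      rw [← he]
      simp only [Category.assoc, Iso.hom_inv_id_assoc]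
      rw [← Category.assoc, sq.fac_right, Category.assoc, Iso.inv_hom_id, Category.comp_id]
    refine OneReduced.sphereBasepoint_app_ne ((sq.lift ≫ e₁.hom).app _
      (SSet.stdSimplex.objEquiv.symm (𝟙 _))) ?_
    exact (ConcreteCategory.congr_hom (NatTrans.congr_app hl (op ⦋2⦌))
      (SSet.stdSimplex.objEquiv.symm (𝟙 _))).symm
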